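/- Let $X=(X_t)_{t\ge 0}$ and $Y=(Y_t)_{t\ge 0}$ be independent real-valued Lévy processes (with càdlàg paths, started at $0$) such that $X_1$ and $Y_1$ are integrable and $m_X=\mathbb E X_1>0$. Put $Z_t=X_t-Y_t$, $m_Y=\mathbb E Y_1$, $\omega_X^2=\mathrm{Var}(X_1)$, $\omega_Y^2=\mathrm{Var}(Y_1)$. Let $V$ be the process $X$ reflected at the barrier $Y$, $$V_t=X_t-\inf_{0\le s\le t}(X_s-Y_s),$$ and for $u\in\mathbb R$ let $\tau(u)=\inf\{t\ge 0: V_t>u\}\in[0,\infty]$ (with $\inf\emptyset=\infty$). Let $N$ denote the standard normal distribution function and let $g:\mathbb R\to\mathbb R$ be an arbitrary function. Set $(m,\omega^2)=(m_X,\omega_X^2)$ if $\mathbb E Z_1>0$, and $(m,\omega^2)=(m_Y,\omega_Y^2)$ if $\mathbb E Z_1<0$. In each of these two cases assume that $0<\omega^2<\infty$ for the variance $\omega^2$ so selected, and put $$x(u)=\frac{g(u)-\frac{u}{m}}{\sqrt{u\,\frac{\omega^2}{m^3}}}\qquad(u>0).$$ Then: 1. For every $u>0$, $$\mathbb P(\tau(u)\le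 g(u))=\mathbb P\left(\frac{\tau(u)-\frac um}{\sqrt{u\,\frac{\omega^2}{m^3}}}\le x(u)\right).$$ 2. $\mathbb P(\tau(u)\le g(u))-N(x(u))\to 0$ as $u\to\infty$. 3. If moreover $x(u)$ is bounded below for all sufficiently large $u$ (so that $N(x(u))$ stays away from $0$), then $\mathbb P(\tau(u)\le g(u))\sim N(x(u))$, that is, $$\lim_{u\to\infty}\frac{\mathbb P(\tau(u)\le g(u))}{N(x(u))}=1.$$ -/

import Mathlib

open MeasureTheory ProbabilityTheory Filter Topology
open scoped NNReal

noncomputable section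

/-- A path `[0, ∞) → ℝ` that is right-continuous and has a finite left limit at every time. -/
def IsCadlagPath (f : ℝ≥0 → ℝ) : Prop :=
  ∀ t, ContinuousWithinAt f (Set.Ici t) t ∧ ∃ l : ℝ, Tendsto f (𝓝[<] t) (𝓝 l)

/-- A real-valued Lévy process: it starts at `0`, its increments are independent and stationary,
and almost every path is càdlàg. -/
structure IsLevyProcess {Ω : Type*} [MeasurableSpace Ω] (X : ℝ≥0 → Ω → ℝ) (P : Measure Ω) :
    Prop where
  measurable : ∀ t, Measurable (X t)
  start_zero : ∀ᵐ ω ∂P, X 0 ω = 0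
  indep_increments : HasIndepIncrements X P
  stationary_increments : ∀ s t, IdentDistrib (fun ω ↦ X (s + t) ω - X s ω) (X t) P P
  cadlag_paths : ∀ᵐ ω ∂P, IsCadlagPath (fun t ↦ X t ω)

/-- The process `X` reflected at the barrier `Y`:
`V_t = X_t - inf_{0 ≤ s ≤ t} (X_s - Y_s)`. -/
def reflectedProcess {Ω : Type*} (X Y : ℝ≥0 → Ω → ℝ) (t : ℝ≥0) (ω : Ω) : ℝ :=
  X t ω - sInf ((fun s ↦ X s ω - Y s ω) '' Set.Icc 0 t)

/-- The first passage time `τ(u) = inf {t ≥ 0 : V_t > u}`, with value `⊤` (that is, `+∞`) if the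
level `u` is never exceeded. -/
def firstPassageTime {Ω : Type*} (V : ℝ≥0 → Ω → ℝ) (u : ℝ) (ω : Ω) : EReal :=
  sInf ((fun t : ℝ≥0 ↦ ((t : ℝ) : EReal)) '' {t | u < V t ω})

/-- The normalisation `√(u ω² / m³)`, as a function of the mean `m`, the variance `ω²` and the
level `u`. -/
def passageScale (m var u : ℝ) : ℝ := √(u * (var / m ^ 3))

/-- The normalised time horizon `(g(u) - u / m) / √(u ω² / m³)`. -/
def normalizedHorizon (m var : ℝ) (g : ℝ → ℝ) (u : ℝ) : ℝ :=
  (g u - u / m) / passageScale m var u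

/-- The distribution function of the standard normal law. -/
def stdNormalCDF (x : ℝ) : ℝ := cdf (gaussianReal 0 1) x

end

/-!
Let `W` be whichever of the two processes governs the passage: `W = X` if
`E (X₁ - Y₁) > 0`, and `W = Y` if `E (X₁ - Y₁) < 0`. In both cases the first passage times of the
reflected process `V` behave like those of `W`, and `W` obeys the central limit theorem.

Write `Z = X - Y`. Since `V_s` is the supremum over `r ≤ s` of `X_s - Z_r`, the choices `r = 0` and
`r = s` give `V ≥ X` and `V ≥ Y`, so that `{W_⌊t⌋ > u}` is contained in `{τ(u) ≤ t}`. Conversely,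
`{τ(u) ≤ t}` requires `X_s - Z_r > u` for some `r ≤ s ≤ n`, where `n = ⌊t⌋ + 1`, and
`X_s - Z_r = X_n - (X_n - X_s) - Z_r = Y_n - (X_n - X_s) + (Z_n - Z_r)`.
The corrections to `X_n` (if `E Z₁ > 0`) or to `Y_n` (if `E Z₁ < 0`) are bounded above in
probability, uniformly in `n` (`exists_measure_excess_le_of_pos`, `exists_measure_excess_le_of_neg`).
This uses only integrability, and rests on two facts about a Lévy process with positive mean:

* it is bounded below (`IsLevyProcess.exists_measure_exists_lt_le`): along the integers by the
  strong law of large numbers, then along dyadic grids, uniformly in the mesh, by an inequality of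
  Ottaviani type (`measure_exists_lt_le_two_mul`), then at all times by right-continuity;
* its increments over intervals ending at `n` are bounded below, uniformly in `n`
  (`IsLevyProcess.exists_forall_measure_exists_sub_lt_le`), by reversing time on each grid.

So `P(τ(u) ≤ t)` lies between upper tails of `W` at neighbouring integer times, up to a bounded
shift of the level and an arbitrarily small error. For `t = u / m + x √(u ω² / m³)` with `x` fixed,
both bounds converge to `N(x)` by the central limit theorem. As `P(τ(u) ≤ t)` is monotone in `t`
and `N` is continuous, Pólya's theorem (`tendsto_sub_of_monotone_of_tendsto`) makes the convergence
uniform in `x`, which allows an arbitrary horizon `g`.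
-/

/-! ### Cumulative distribution functions and uniformity of weak convergence -/

/-- **Pólya's theorem**, evaluated along an arbitrary choice of points: monotone functions with
values in `[0, 1]` that converge pointwise to a continuous function with limits `0` and `1` at
`±∞` converge uniformly. -/
theorem tendsto_sub_of_monotone_of_tendsto {ι : Type*} {l : Filter ι} {F : ι → ℝ → ℝ} {Φ : ℝ → ℝ}
    (hmono : ∀ i, Monotone (F i)) (h0 : ∀ i y, 0 ≤ F i y) (h1 : ∀ i y, F i y ≤ 1)
    (hlim : ∀ y, Tendsto (fun i ↦ F i y) l (𝓝 (Φ y))) (hΦ : Continuous Φ)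
    (hbot : Tendsto Φ atBot (𝓝 0)) (htop : Tendsto Φ atTop (𝓝 1)) (x : ι → ℝ) :
    Tendsto (fun i ↦ F i (x i) - Φ (x i)) l (𝓝 0) := by
  -- By compactness of `EReal`, the points `x i` converge along every ultrafilter.
  rw [tendsto_iff_ultrafilter]
  intro U hU
  have hlimU : ∀ y, Tendsto (fun i ↦ F i y) U (𝓝 (Φ y)) := fun y ↦ (hlim y).mono_left hU
  obtain ⟨a, -, ha⟩ := isCompact_univ.ultrafilter_le_nhds
    (U.map fun i ↦ (x i : EReal)) (by simp)
  have ha : Tendsto (fun i ↦ (x i : EReal)) U (𝓝 a) := ha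
  induction a with
  | bot =>
    have hx : Tendsto x U atBot := by
      refine tendsto_atBot.2 fun b ↦ ?_
      filter_upwards [ha.eventually_lt_const (EReal.bot_lt_coe b)] with i hi
      exact_mod_cast hi.le
    have : Tendsto (fun i ↦ F i (x i)) U (𝓝 0) := by
      refine tendsto_order.2 ⟨fun b hb ↦ .of_forall fun i ↦ hb.trans_le (h0 i _), fun b hb ↦ ?_⟩
      obtain ⟨y, hy⟩ := (hbot.eventually_lt_const hb).exists
      filter_upwards [(hlimU y).eventually_lt_const hy, hx.eventually_le_atBot y] with i hi hi'
      exact (hmono i hi').trans_lt hi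
    simpa using this.sub (hbot.comp hx)
  | top =>
    have hx : Tendsto x U atTop := by
      refine tendsto_atTop.2 fun b ↦ ?_
      filter_upwards [ha.eventually_const_lt (EReal.coe_lt_top b)] with i hi
      exact_mod_cast hi.le
    have : Tendsto (fun i ↦ F i (x i)) U (𝓝 1) := by
      refine tendsto_order.2 ⟨fun b hb ↦ ?_, fun b hb ↦ .of_forall fun i ↦ (h1 i _).trans_lt hb⟩
      obtain ⟨y, hy⟩ := (htop.eventually_const_lt hb).exists
      filter_upwards [(hlimU y).eventually_const_lt hy, hx.eventually_ge_atTop y] with i hi hi'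
      exact hi.trans_le (hmono i hi')
    simpa using this.sub (htop.comp hx)
  | coe a =>
    have hx : Tendsto x U (𝓝 a) := EReal.tendsto_coe.1 ha
    have : Tendsto (fun i ↦ F i (x i)) U (𝓝 (Φ a)) := by
      refine tendsto_order.2 ⟨fun b hb ↦ ?_, fun b hb ↦ ?_⟩
      · obtain ⟨y, hy, hya⟩ := ((hΦ.tendsto a).mono_left nhdsWithin_le_nhds |>.eventually_const_lt hb
          |>.and (self_mem_nhdsWithin (s := Set.Iio a))).exists
        filter_upwards [(hlimU y).eventually_const_lt hy, hx.eventually_const_lt hya] with i hi hi'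
        exact hi.trans_le (hmono i hi'.le)
      · obtain ⟨y, hy, hya⟩ := ((hΦ.tendsto a).mono_left nhdsWithin_le_nhds |>.eventually_lt_const hb
          |>.and (self_mem_nhdsWithin (s := Set.Ioi a))).exists
        filter_upwards [(hlimU y).eventually_lt_const hy, hx.eventually_lt_const hya] with i hi hi'
        exact (hmono i hi'.le).trans_lt hi
    simpa using this.sub ((hΦ.tendsto a).comp hx)

theorem continuous_stdNormalCDF : Continuous stdNormalCDF := by
  refine continuous_iff_continuousAt.2 fun x ↦ ?_
  have := nullSingletonClass_gaussianReal (μ := 0) (v := 1) one_ne_zero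
  refine (cdf (gaussianReal 0 1)).mono.continuousAt_iff_leftLim_eq_rightLim.2 ?_
  have h : (cdf (gaussianReal 0 1)).measure {x} = 0 := by simp [measure_cdf]
  rw [StieltjesFunction.measure_singleton, ENNReal.ofReal_eq_zero] at h
  rw [StieltjesFunction.rightLim_eq]
  exact le_antisymm ((cdf _).mono.leftLim_le le_rfl) (by linarith)

theorem monotone_stdNormalCDF : Monotone stdNormalCDF := monotone_cdf _

theorem stdNormalCDF_pos (x : ℝ) : 0 < stdNormalCDF x := by
  have : (gaussianReal 0 1) (Set.Iic x) ≠ 0 := fun h ↦ by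
    have := (gaussianReal_absolutelyContinuous' 0 one_ne_zero) h
    simp at this
  rw [stdNormalCDF, cdf_eq_real]
  exact ENNReal.toReal_pos this (by simp)

/-- The standard normal law is symmetric. -/
theorem gaussianReal_real_Ioi_neg (x : ℝ) :
    (gaussianReal 0 1).real (Set.Ioi (-x)) = stdNormalCDF x := by
  have := nullSingletonClass_gaussianReal (μ := 0) (v := 1) one_ne_zero
  have h : (gaussianReal 0 1).map (fun y ↦ -y) = gaussianReal 0 1 := by
    simp [gaussianReal_map_neg]
  rw [stdNormalCDF, cdf_eq_real, ← measureReal_congr (Iio_ae_eq_Iic (a := x))]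
  conv_rhs => rw [← h]
  rw [map_measureReal_apply (by fun_prop) measurableSet_Iio]
  congr 1
  ext y
  simp

/-! ### Càdlàg paths -/

theorem IsCadlagPath.neg {f : ℝ≥0 → ℝ} (hf : IsCadlagPath f) : IsCadlagPath (fun t ↦ -f t) :=
  fun t ↦ ⟨(hf t).1.neg, let ⟨l, hl⟩ := (hf t).2; ⟨-l, hl.neg⟩⟩

theorem IsCadlagPath.add {f g : ℝ≥0 → ℝ} (hf : IsCadlagPath f) (hg : IsCadlagPath g) :
    IsCadlagPath (fun t ↦ f t + g t) :=
  fun t ↦ ⟨(hf t).1.add (hg t).1,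
    let ⟨l, hl⟩ := (hf t).2; let ⟨k, hk⟩ := (hg t).2; ⟨l + k, hl.add hk⟩⟩

/-- A càdlàg path is bounded on compact time intervals. -/
theorem IsCadlagPath.exists_abs_le {f : ℝ≥0 → ℝ} (hf : IsCadlagPath f) (T : ℝ≥0) :
    ∃ C : ℝ, ∀ t ≤ T, |f t| ≤ C := by
  have key : ∃ C : ℝ, ∀ t ∈ Set.Icc 0 T, |f t| ≤ C := by
    refine (isCompact_Icc (a := (0 : ℝ≥0)) (b := T)).induction_on
      (p := fun s ↦ ∃ C : ℝ, ∀ t ∈ s, |f t| ≤ C) ⟨0, by simp⟩ ?_ ?_ ?_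
    · rintro s t hst ⟨C, hC⟩
      exact ⟨C, fun x hx ↦ hC x (hst hx)⟩
    · rintro s t ⟨C, hC⟩ ⟨D, hD⟩
      exact ⟨max C D, fun x hx ↦ hx.elim (fun h ↦ (hC x h).trans (le_max_left _ _))
        fun h ↦ (hD x h).trans (le_max_right _ _)⟩
    · intro t _
      obtain ⟨hr, l, hl⟩ := hf t
      have h1 : ∀ᶠ s in 𝓝[≥] t, |f s| < |f t| + 1 :=
        hr.abs.tendsto.eventually_lt_const (lt_add_one _)
      have h2 : ∀ᶠ s in 𝓝[<] t, |f s| < |l| + 1 := hl.abs.eventually_lt_const (lt_add_one _)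
      have h3 : ∀ᶠ s in 𝓝 t, |f s| ≤ max (|f t| + 1) (|l| + 1) := by
        rw [← nhdsLT_sup_nhdsGE, eventually_sup]
        exact ⟨h2.mono fun s hs ↦ hs.le.trans (le_max_right _ _),
          h1.mono fun s hs ↦ hs.le.trans (le_max_left _ _)⟩
      exact ⟨_, mem_nhdsWithin_of_mem_nhds h3, _, fun s hs ↦ hs⟩
  exact ⟨key.choose, fun t ht ↦ key.choose_spec t ⟨zero_le, ht⟩⟩

/-! ### Normalising the passage time -/

theorem passageScale_pos {m var u : ℝ} (hm : 0 < m) (hvar : 0 < var) (hu : 0 < u) :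
    0 < passageScale m var u := Real.sqrt_pos.2 (by positivity)

/-- An inequality between a passage time and a real number is unchanged by an affine
normalisation, also when the passage time is infinite. -/
theorem EReal.sub_div_le_sub_div_iff {τ : EReal} {a s g : ℝ} (hs : 0 < s) :
    (τ - (a : EReal)) / (s : EReal) ≤ (((g - a) / s : ℝ) : EReal) ↔ τ ≤ (g : EReal) := by
  induction τ with
  | bot => simp [EReal.bot_div_of_pos_ne_top (EReal.coe_pos.2 hs) (EReal.coe_ne_top s)]
  | top => simp [EReal.top_div_of_pos_ne_top (EReal.coe_pos.2 hs) (EReal.coe_ne_top s)]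
  | coe t =>
    rw [← EReal.coe_sub, ← EReal.coe_div, EReal.coe_le_coe_iff, EReal.coe_le_coe_iff,
      div_le_div_iff_of_pos_right hs, sub_le_sub_iff_right]

/-! ### Sums of independent Lévy processes -/

/-- If two independent random vectors both have independent coordinates, so has their sum. -/
theorem ProbabilityTheory.iIndepFun.add_of_indepFun {Ω ι : Type*} [Fintype ι] [MeasurableSpace Ω]
    {P : Measure Ω} [IsProbabilityMeasure P] {A B : ι → Ω → ℝ} (hA : ∀ i, Measurable (A i))
    (hB : ∀ i, Measurable (B i)) (hAi : iIndepFun A P) (hBi : iIndepFun B P)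
    (hAB : IndepFun (fun ω i ↦ A i ω) (fun ω i ↦ B i ω) P) :
    iIndepFun (fun i ω ↦ A i ω + B i ω) P := by
  refine (iIndepFun_iff_charFun_pi (X := fun i ω ↦ A i ω + B i ω)
    fun i ↦ ((hA i).add (hB i)).aemeasurable).2 fun t ↦ ?_
  have hcoord (i : ι) : IndepFun (A i) (B i) P :=
    hAB.comp (measurable_pi_apply i) (measurable_pi_apply i)
  have hL : IndepFun (fun ω ↦ WithLp.toLp 2 (A · ω)) (fun ω ↦ WithLp.toLp 2 (B · ω)) P :=
    hAB.comp (WithLp.measurable_toLp 2 _) (WithLp.measurable_toLp 2 _)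
  have key := hL.charFun_map_fun_add_eq_mul (by fun_prop) (by fun_prop)
  have hsum : (fun ω ↦ WithLp.toLp 2 (fun i ↦ A i ω + B i ω)) =
      fun ω ↦ WithLp.toLp 2 (A · ω) + WithLp.toLp 2 (B · ω) := rfl
  rw [hsum, key, Pi.mul_apply,
    (iIndepFun_iff_charFun_pi fun i ↦ (hA i).aemeasurable).1 hAi t,
    (iIndepFun_iff_charFun_pi fun i ↦ (hB i).aemeasurable).1 hBi t, ← Finset.prod_mul_distrib]
  refine Finset.prod_congr rfl fun i _ ↦ ?_
  rw [(hcoord i).charFun_map_fun_add_eq_mul (hA i).aemeasurable (hB i).aemeasurable]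
  rfl

namespace IsLevyProcess

variable {Ω : Type*} [MeasurableSpace Ω] {P : Measure Ω} {X Y : ℝ≥0 → Ω → ℝ}

theorem neg (hX : IsLevyProcess X P) : IsLevyProcess (fun t ω ↦ -X t ω) P where
  measurable t := (hX.measurable t).neg
  start_zero := hX.start_zero.mono fun ω h ↦ by simp [h]
  indep_increments := hX.indep_increments.neg
  stationary_increments s t := by
    convert! (hX.stationary_increments s t).comp measurable_neg using 1
    ext ω
    simp only [Function.comp_apply]
    ring
  cadlag_paths := hX.cadlag_paths.mono fun ω h ↦ h.neg

theorem add [IsProbabilityMeasure P] (hX : IsLevyProcess X P) (hY : IsLevyProcess Y P)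
    (hXY : IndepFun (fun ω t ↦ X t ω) (fun ω t ↦ Y t ω) P) :
    IsLevyProcess (fun t ω ↦ X t ω + Y t ω) P where
  measurable t := (hX.measurable t).add (hY.measurable t)
  start_zero := by
    filter_upwards [hX.start_zero, hY.start_zero] with ω h h'
    simp [h, h']
  indep_increments n t ht := by
    convert! iIndepFun.add_of_indepFun
      (A := fun (i : Fin n) ω ↦ X (t i.succ) ω - X (t i.castSucc) ω)
      (B := fun (i : Fin n) ω ↦ Y (t i.succ) ω - Y (t i.castSucc) ω)
      (fun i ↦ (hX.measurable _).sub (hX.measurable _))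
      (fun i ↦ (hY.measurable _).sub (hY.measurable _)) (hX.indep_increments n t ht) (hY.indep_increments n t ht) ?_
      using 3 with i ω
    · simp only
      ring
    · have hφ : Measurable fun (f : ℝ≥0 → ℝ) (i : Fin n) ↦ f (t i.succ) - f (t i.castSucc) := by
        fun_prop
      exact hXY.comp hφ hφ
  stationary_increments s t := by
    have hφ : Measurable fun f : ℝ≥0 → ℝ ↦ f (s + t) - f s := by fun_prop
    have h := ((hX.stationary_increments s t).prodMk (hY.stationary_increments s t)
      (hXY.comp hφ hφ) (hXY.comp (measurable_pi_apply t) (measurable_pi_apply t))).comp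
      (measurable_fst.add measurable_snd)
    convert! h using 1
    ext ω
    simp only [Function.comp_apply, Pi.add_apply]
    ring
  cadlag_paths := by
    filter_upwards [hX.cadlag_paths, hY.cadlag_paths] with ω h h' using h.add h'

theorem sub [IsProbabilityMeasure P] (hX : IsLevyProcess X P) (hY : IsLevyProcess Y P)
    (hXY : IndepFun (fun ω t ↦ X t ω) (fun ω t ↦ Y t ω) P) :
    IsLevyProcess (fun t ω ↦ X t ω - Y t ω) P := by
  have hφ : Measurable fun (f : ℝ≥0 → ℝ) t ↦ -f t := by fun_prop
  simpa only [sub_eq_add_neg] using hX.add hY.neg (hXY.comp measurable_id hφ)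

end IsLevyProcess

/-! ### Measure-theoretic preliminaries -/

section Measure

variable {Ω : Type*} [MeasurableSpace Ω] {P : Measure Ω}

theorem exists_lt_measure_of_ae_exists_mem [IsProbabilityMeasure P] {A : ℕ → Set Ω}
    (hA : Monotone A) (h : ∀ᵐ ω ∂P, ∃ n, ω ∈ A n) {c : ENNReal} (hc : c < 1) : ∃ n, c < P (A n) := by
  have h1 : P (⋃ n, A n) = 1 := by
    rw [← measure_univ (μ := P)]
    refine measure_congr (eventuallyEq_univ.2 ?_)
    filter_upwards [h] with ω hω using Set.mem_iUnion.2 hω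
  rw [hA.measure_iUnion] at h1
  exact lt_iSup_iff.1 (h1 ▸ hc)

theorem measure_le_of_ae_eventually_mem {A : Set Ω} {E : ℕ → Set Ω} {ε : ENNReal}
    (hE : ∀ j, P (E j) ≤ ε) (h : ∀ᵐ ω ∂P, ω ∈ A → ∀ᶠ j in atTop, ω ∈ E j) : P A ≤ ε := by
  have hmono : Monotone fun J ↦ ⋂ j ≥ J, E j := fun J J' hJ ↦
    Set.biInter_subset_biInter_left fun j hj ↦ hJ.trans hj
  calc P A ≤ P (⋃ J, ⋂ j ≥ J, E j) := by
        refine measure_mono_ae ?_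
        filter_upwards [h] with ω hω hA
        obtain ⟨J, hJ⟩ := eventually_atTop.1 (hω hA)
        exact Set.mem_iUnion.2 ⟨J, Set.mem_iInter₂.2 hJ⟩
    _ = ⨆ J, P (⋂ j ≥ J, E j) := hmono.measure_iUnion
    _ ≤ ε := iSup_le fun J ↦ (measure_mono (Set.biInter_subset_of_mem le_rfl)).trans (hE J)

/-- **Ottaviani's inequality** for the minimum of a sequence `S`. The comparison sequence `S'` is
such that `S' k - S k` is independent of `S 0, …, S k` and is less than `K` with probability at
least `1 / 2`; applied at the first index where `S` drops below `-2K`, this shows that `S'` drops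
below `-K` at least half as often as `S` drops below `-2K`. -/
theorem measure_exists_lt_le_two_mul {S S' : ℕ → Ω → ℝ} {K : ℝ} (hS : ∀ k, Measurable (S k))
    (hS' : ∀ k, Measurable (S' k))
    (hind : ∀ k : ℕ, IndepFun (fun ω (i : Fin (k + 1)) ↦ S i ω) (fun ω ↦ S' k ω - S k ω) P)
    (hhalf : ∀ k, 1 / 2 ≤ P {ω | S' k ω - S k ω < K}) :
    P {ω | ∃ k, S k ω < -(2 * K)} ≤ 2 * P {ω | ∃ k, S' k ω < -K} := by
  -- `E k`: the sequence `S` drops below `-2K` for the first time at index `k`.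
  set E : ℕ → Set Ω := fun k ↦ {ω | S k ω < -(2 * K) ∧ ∀ i < k, ¬ S i ω < -(2 * K)} with hE
  set G : ℕ → Set Ω := fun k ↦ {ω | S' k ω - S k ω < K} with hG
  have hEm : ∀ k, MeasurableSet (E k) := fun k ↦ by
    refine (measurableSet_lt (hS k) measurable_const).inter ?_
    have : {ω | ∀ i < k, ¬ S i ω < -(2 * K)} = ⋂ i < k, {ω | S i ω < -(2 * K)}ᶜ := by
      ext ω; simp
    change MeasurableSet {ω | ∀ i < k, ¬ S i ω < -(2 * K)}
    rw [this]
    exact .iInter fun i ↦ .iInter fun _ ↦ (measurableSet_lt (hS i) measurable_const).compl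
  have hGm : ∀ k, MeasurableSet (G k) := fun k ↦
    measurableSet_lt ((hS' k).sub (hS k)) measurable_const
  have hdisj : Pairwise (Function.onFun Disjoint E) := by
    intro i j hij
    refine Set.disjoint_left.2 fun ω hi hj ↦ ?_
    rcases lt_or_gt_of_ne hij with h | h
    exacts [hj.2 i h hi.1, hi.2 j h hj.1]
  have hinter : ∀ k, P (E k ∩ G k) = P (E k) * P (G k) := by
    intro k
    let B : Set (Fin (k + 1) → ℝ) :=
      {v | v (Fin.last k) < -(2 * K)} ∩ ⋂ i : Fin k, {v | v i.castSucc < -(2 * K)}ᶜ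
    have hB : MeasurableSet B :=
      (measurableSet_lt (measurable_pi_apply _) measurable_const).inter <|
        .iInter fun i ↦ (measurableSet_lt (measurable_pi_apply _) measurable_const).compl
    have hEB : E k = (fun ω (i : Fin (k + 1)) ↦ S i ω) ⁻¹' B := by
      ext ω
      simp only [hE, B, Set.mem_ofPred_eq, Set.mem_preimage, Set.mem_inter_iff, Set.mem_iInter,
        Set.mem_compl_iff, Fin.val_last, Fin.val_castSucc]
      exact and_congr_right fun _ ↦ ⟨fun h i ↦ h i i.2, fun h i hi ↦ h ⟨i, hi⟩⟩
    rw [hEB]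
    exact (hind k).measure_inter_preimage_eq_mul B (Set.Iio K) hB measurableSet_Iio
  have hle : ∀ k, P (E k) ≤ 2 * P (E k ∩ G k) := by
    intro k
    calc P (E k) = 2 * (P (E k) * (1 / 2)) := by
          rw [mul_left_comm, one_div, ENNReal.mul_inv_cancel (by simp) (by simp), mul_one]
      _ ≤ 2 * P (E k ∩ G k) := by rw [hinter]; gcongr; exact hhalf k
  calc P {ω | ∃ k, S k ω < -(2 * K)} ≤ P (⋃ k, E k) := by
        classical
        refine measure_mono fun ω hω ↦ ?_
        exact Set.mem_iUnion.2 ⟨Nat.find hω, Nat.find_spec hω, fun i hi ↦ Nat.find_min hω hi⟩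
    _ = ∑' k, P (E k) := measure_iUnion hdisj hEm
    _ ≤ ∑' k, 2 * P (E k ∩ G k) := ENNReal.tsum_le_tsum hle
    _ = 2 * P (⋃ k, E k ∩ G k) := by
        rw [ENNReal.tsum_mul_left, measure_iUnion
          (fun i j hij ↦ (hdisj hij).mono Set.inter_subset_left Set.inter_subset_left)
          fun k ↦ (hEm k).inter (hGm k)]
    _ ≤ 2 * P {ω | ∃ k, S' k ω < -K} := by
        gcongr
        refine Set.iUnion_subset fun k ω ⟨h1, h2⟩ ↦ ⟨k, ?_⟩
        have h3 : S k ω < -(2 * K) := h1.1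
        have h4 : S' k ω - S k ω < K := h2
        linarith

end Measure

/-- A right-continuous path that is in an open set at time `s` is in it at a dyadic time shortly
after `s`, on every sufficiently fine dyadic grid. -/
theorem IsCadlagPath.eventually_exists_dyadic {f : ℝ≥0 → ℝ} (hf : IsCadlagPath f) {s T : ℝ≥0}
    (hsT : s < T) {U : Set ℝ} (hU : IsOpen U) (hs : f s ∈ U) :
    ∀ᶠ j : ℕ in atTop, ∃ k : ℕ, (k : ℝ≥0) / 2 ^ j ≤ T ∧ f ((k : ℝ≥0) / 2 ^ j) ∈ U := by
  have hge : ∀ j : ℕ, s ≤ (⌈s * 2 ^ j⌉₊ : ℝ≥0) / 2 ^ j := fun j ↦ by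
    rw [le_div_iff₀ (by positivity)]
    exact Nat.le_ceil _
  have hlt : ∀ j : ℕ, (⌈s * 2 ^ j⌉₊ : ℝ≥0) / 2 ^ j ≤ s + (1 / 2) ^ j := fun j ↦ by
    rw [div_le_iff₀ (by positivity), add_mul, ← mul_pow]
    simpa using (Nat.ceil_lt_add_one (zero_le (a := s * 2 ^ j))).le
  have hlim : Tendsto (fun j : ℕ ↦ (⌈s * 2 ^ j⌉₊ : ℝ≥0) / 2 ^ j) atTop (𝓝[≥] s) := by
    refine tendsto_nhdsWithin_iff.2 ⟨?_, .of_forall hge⟩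
    refine tendsto_of_tendsto_of_tendsto_of_le_of_le tendsto_const_nhds ?_ hge hlt
    have h2 : Tendsto (fun j : ℕ ↦ (1 / 2 : ℝ≥0) ^ j) atTop (𝓝 0) :=
      NNReal.tendsto_pow_atTop_nhds_zero_of_lt_one (by rw [← NNReal.coe_lt_coe]; norm_num)
    simpa using h2.const_add s
  have h1 := ((hf s).1.tendsto.comp hlim).eventually_mem (hU.mem_nhds hs)
  have h2 := (hlim.mono_right nhdsWithin_le_nhds).eventually_le_const hsT
  filter_upwards [h1, h2] with j hj1 hj2 using ⟨_, hj2, hj1⟩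

namespace IsLevyProcess

variable {Ω : Type*} [MeasurableSpace Ω] {P : Measure Ω}
  {X : ℝ≥0 → Ω → ℝ}

theorem identDistrib_sub (hX : IsLevyProcess X P) {s t : ℝ≥0} (hst : s ≤ t) :
    IdentDistrib (fun ω ↦ X t ω - X s ω) (X (t - s)) P P := by
  simpa [add_tsub_cancel_of_le hst] using hX.stationary_increments s (t - s)

/-- The values of a Lévy process up to time `t k` are independent of the increment over
`[t k, T]`. -/
theorem indepFun_past_increment (hX : IsLevyProcess X P) {t : ℕ → ℝ≥0} (ht : Monotone t)
    (ht0 : t 0 = 0) {k : ℕ} {T : ℝ≥0} (hT : t k ≤ T) :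
    IndepFun (fun ω (i : Fin (k + 1)) ↦ X (t i) ω) (fun ω ↦ X T ω - X (t k) ω) P := by
  -- Continuing `t 0, …, t k` by `T` makes the increment over `[t k, T]` the one with index `k`.
  set t' : ℕ → ℝ≥0 := fun i ↦ if i ≤ k then t i else T with ht'
  have hmono : Monotone t' := by
    intro i j hij
    simp only [ht']
    split_ifs with h1 h2 h2
    · exact ht hij
    · exact (ht h1).trans hT
    · omega
    · exact le_rfl
  set ξ : ℕ → Ω → ℝ := fun i ω ↦ X (t' (i + 1)) ω - X (t' i) ω with hξ
  have hξm : ∀ i, Measurable (ξ i) := fun i ↦ (hX.measurable _).sub (hX.measurable _)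
  have h := (hX.indep_increments.nat hmono).indepFun_finset (Finset.range k) {k} (by simp) hξm
  let φ : (Finset.range k → ℝ) → Fin (k + 1) → ℝ :=
    fun v i ↦ ∑ j : Finset.range k, if j.1 < i then v j else 0
  have hφ : Measurable φ := by
    refine measurable_pi_lambda _ fun i ↦ Finset.measurable_fun_sum _ fun j _ ↦ ?_
    split_ifs
    · exact measurable_pi_apply j
    · exact measurable_const
  have h2 := h.comp hφ (measurable_pi_apply (⟨k, by simp⟩ : ({k} : Finset ℕ)))
  refine h2.congr ?_ (.of_forall fun ω ↦ ?_)
  · filter_upwards [hX.start_zero] with ω hω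
    ext i
    have hi : (i : ℕ) ≤ k := Nat.lt_succ_iff.1 i.2
    have hfil : (Finset.range k).filter (· < (i : ℕ)) = Finset.range i := by
      ext j
      simp only [Finset.mem_filter, Finset.mem_range]
      omega
    simp only [Function.comp_apply, φ]
    rw [Finset.sum_coe_sort (Finset.range k) (fun j ↦ if j < (i : ℕ) then ξ j ω else 0),
      ← Finset.sum_filter, hfil, Finset.sum_range_sub (fun j ↦ X (t' j) ω)]
    simp [ht', hi, ht0, hω]
  · simp [ht']

theorem ae_exists_forall_abs_le (hX : IsLevyProcess X P) (T : ℝ≥0) :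
    ∀ᵐ ω ∂P, ∃ n : ℕ, ∀ s ≤ T, |X s ω| ≤ n := by
  filter_upwards [hX.cadlag_paths] with ω hω
  obtain ⟨C, hC⟩ := hω.exists_abs_le T
  obtain ⟨n, hn⟩ := exists_nat_ge C
  exact ⟨n, fun s hs ↦ (hC s hs).trans hn⟩

/-- By the strong law of large numbers, a Lévy process with positive mean is bounded below along
the integers. -/
theorem exists_measure_exists_nat_lt_le [IsProbabilityMeasure P]
    (hX : IsLevyProcess X P) (hint : Integrable (X 1) P)
    (hpos : 0 < ∫ ω, X 1 ω ∂P) {ε : ENNReal} (hε : ε ≠ 0) :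
    ∃ K : ℕ, P {ω | ∃ n : ℕ, X n ω < -K} ≤ ε := by
  set ξ : ℕ → Ω → ℝ := fun i ω ↦ X ((i + 1 : ℕ) : ℝ≥0) ω - X (i : ℝ≥0) ω with hξ
  have hid : ∀ i, IdentDistrib (ξ i) (X 1) P P := fun i ↦ by
    simpa [hξ] using hX.stationary_increments i 1
  have hindep : iIndepFun ξ P := hX.indep_increments.nat (t := fun i : ℕ ↦ (i : ℝ≥0)) Nat.mono_cast
  have hlln := strong_law_ae_real ξ ((hid 0).integrable_iff.2 hint)
    (fun i j hij ↦ hindep.indepFun hij) fun i ↦ (hid i).trans (hid 0).symm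
  have hbdd : ∀ᵐ ω ∂P, ∃ K : ℕ, ω ∈ {ω | ∀ n : ℕ, -(K : ℝ) ≤ X n ω} := by
    filter_upwards [hlln, hX.start_zero] with ω hω h0
    rw [(hid 0).integral_eq] at hω
    obtain ⟨N, hN⟩ := eventually_atTop.1 (hω.eventually_const_lt hpos)
    obtain ⟨K, hK⟩ := exists_nat_ge (∑ n ∈ Finset.range N, |X n ω|)
    refine ⟨K, fun n ↦ ?_⟩
    rcases lt_or_ge n N with h | h
    · have h1 := Finset.single_le_sum (f := fun n : ℕ ↦ |X n ω|) (fun i _ ↦ abs_nonneg _)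
        (Finset.mem_range.2 h)
      have h2 := neg_abs_le (X n ω)
      linarith
    · have h1 := hN n h
      have h2 : ∑ i ∈ Finset.range n, ξ i ω = X n ω := by
        rw [hξ, Finset.sum_range_sub (fun i : ℕ ↦ X (i : ℝ≥0) ω)]
        simp [h0]
      rw [h2] at h1
      have h3 : 0 < X n ω := by
        by_contra! h4
        exact absurd h1 (not_lt.2 (div_nonpos_of_nonpos_of_nonneg h4 (Nat.cast_nonneg n)))
      have h4 : (0 : ℝ) ≤ K := K.cast_nonneg
      linarith
  have hmono : Monotone fun K : ℕ ↦ {ω | ∀ n : ℕ, -(K : ℝ) ≤ X n ω} := by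
    intro K L hKL ω hω n
    have : (K : ℝ) ≤ L := by exact_mod_cast hKL
    have := hω n
    linarith
  obtain ⟨K, hK⟩ := exists_lt_measure_of_ae_exists_mem hmono hbdd
    (ENNReal.sub_lt_self ENNReal.one_ne_top one_ne_zero hε)
  refine ⟨K, ?_⟩
  have hm : MeasurableSet {ω | ∀ n : ℕ, -(K : ℝ) ≤ X n ω} := by
    simp only [Set.ofPred_forall]
    exact .iInter fun n ↦ measurableSet_le measurable_const (hX.measurable _)
  have hc : {ω | ∃ n : ℕ, X n ω < -K} = {ω | ∀ n : ℕ, -(K : ℝ) ≤ X n ω}ᶜ := by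
    ext ω; simp
  rw [hc, prob_compl_eq_one_sub hm]
  exact tsub_le_iff_tsub_le.1 hK.le

/-- A Lévy process with positive mean is bounded below along every dyadic grid, uniformly in the
mesh: Ottaviani's inequality compares the grid with the integers. -/
theorem exists_measure_exists_dyadic_lt_le [IsProbabilityMeasure P]
    (hX : IsLevyProcess X P) (hint : Integrable (X 1) P)
    (hpos : 0 < ∫ ω, X 1 ω ∂P) {ε : ENNReal} (hε : ε ≠ 0) :
    ∃ K : ℝ, ∀ j : ℕ, P {ω | ∃ k : ℕ, X ((k : ℝ≥0) / 2 ^ j) ω < -K} ≤ ε := by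
  obtain ⟨K₁, hK₁⟩ := hX.exists_measure_exists_nat_lt_le hint hpos (ε := ε / 2) (by simp [hε])
  obtain ⟨K₂, hK₂⟩ := exists_lt_measure_of_ae_exists_mem (P := P)
    (A := fun n : ℕ ↦ {ω | ∀ s ≤ 1, |X s ω| ≤ n})
    (fun m n hmn ω hω s hs ↦ (hω s hs).trans (by exact_mod_cast hmn))
    (hX.ae_exists_forall_abs_le 1) (c := 1 / 2)
    (by simp)
  set K : ℝ := K₁ + K₂ + 1 with hK
  have hKK₁ : (K₁ : ℝ) ≤ K := by have := K₂.cast_nonneg (α := ℝ); linarith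
  have hKK₂ : (K₂ : ℝ) < K := by have := K₁.cast_nonneg (α := ℝ); linarith
  refine ⟨2 * K, fun j ↦ ?_⟩
  have hmono : Monotone fun k : ℕ ↦ (k : ℝ≥0) / 2 ^ j := fun k l hkl ↦ by
    dsimp only
    gcongr
  calc P {ω | ∃ k : ℕ, X ((k : ℝ≥0) / 2 ^ j) ω < -(2 * K)}
      ≤ 2 * P {ω | ∃ k : ℕ, X (⌈(k : ℝ≥0) / 2 ^ j⌉₊ : ℝ≥0) ω < -K} := by
        refine measure_exists_lt_le_two_mul (S := fun k ↦ X ((k : ℝ≥0) / 2 ^ j))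
          (S' := fun k ↦ X (⌈(k : ℝ≥0) / 2 ^ j⌉₊ : ℝ≥0)) (fun k ↦ hX.measurable _)
          (fun k ↦ hX.measurable _)
          (fun k ↦ hX.indepFun_past_increment hmono (by simp) (Nat.le_ceil _)) fun k ↦ ?_
        have hid := hX.identDistrib_sub (Nat.le_ceil ((k : ℝ≥0) / 2 ^ j))
        have h1 : (⌈(k : ℝ≥0) / 2 ^ j⌉₊ : ℝ≥0) - (k : ℝ≥0) / 2 ^ j ≤ 1 :=
          tsub_le_iff_left.2 (Nat.ceil_lt_add_one zero_le).le
        change _ ≤ P ((fun ω ↦ X (⌈(k : ℝ≥0) / 2 ^ j⌉₊ : ℝ≥0) ω - X ((k : ℝ≥0) / 2 ^ j) ω) ⁻¹'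
          Set.Iio K)
        rw [hid.measure_mem_eq measurableSet_Iio]
        refine hK₂.le.trans (measure_mono fun ω hω ↦ ?_)
        exact ((le_abs_self _).trans (hω _ h1)).trans_lt hKK₂
    _ ≤ 2 * P {ω | ∃ n : ℕ, X n ω < -K₁} := by
        refine mul_le_mul_right (measure_mono ?_) 2
        rintro ω ⟨k, hk⟩
        exact ⟨_, hk.trans_le (neg_le_neg hKK₁)⟩
    _ ≤ 2 * (ε / 2) := by gcongr
    _ = ε := ENNReal.mul_div_cancel (by simp) (by simp)

/-- Time reversal on a grid: reversing the order of the independent and identically distributed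
increments over the cells of the grid does not change their joint law. -/
theorem measure_exists_sub_lt_eq (hX : IsLevyProcess X P) (N : ℕ) (h : ℝ≥0) (K : ℝ) :
    P {ω | ∃ k ≤ N, X (N * h) ω - X (k * h) ω < -K} = P {ω | ∃ k ≤ N, X (k * h) ω < -K} := by
  set ξ : ℕ → Ω → ℝ := fun i ω ↦ X ((i + 1 : ℕ) * h) ω - X (i * h) ω with hξ
  have hid : ∀ i, IdentDistrib (ξ i) (X h) P P := fun i ↦ by
    simpa [hξ, add_mul] using hX.stationary_increments (i * h) h
  have hindep : iIndepFun ξ P := hX.indep_increments.nat (t := fun i : ℕ ↦ (i : ℝ≥0) * h)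
    fun i j hij ↦ by dsimp only; gcongr
  let e : Fin N → ℕ := fun i ↦ N - 1 - i
  have he : Function.Injective e := fun i j hij ↦ by
    have := i.2; have := j.2
    simp only [e] at hij
    ext; omega
  have hpi : IdentDistrib (fun ω (i : Fin N) ↦ ξ i ω) (fun ω (i : Fin N) ↦ ξ (e i) ω) P P :=
    .pi (fun i ↦ (hid _).trans (hid _).symm) (hindep.precomp Fin.val_injective)
      (hindep.precomp he)
  let B : Set (Fin N → ℝ) := ⋃ k : Fin (N + 1), {v | ∑ i : Fin N with i.1 < k.1, v i < -K}
  have hB : MeasurableSet B := .iUnion fun k ↦ measurableSet_lt (by fun_prop) measurable_const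
  have hsum (k : Fin (N + 1)) (f : ℕ → ℝ) :
      ∑ i : Fin N with i.1 < k.1, f i = ∑ i ∈ Finset.range k, f i := by
    have hfil : (Finset.range N).filter (· < (k : ℕ)) = Finset.range k := by
      ext j
      simp only [Finset.mem_filter, Finset.mem_range]
      omega
    rw [Finset.sum_filter, Fin.sum_univ_eq_sum_range (fun i ↦ if i < k.1 then f i else 0) N,
      ← Finset.sum_filter, hfil]
  have hfwd : {ω | ∃ k ≤ N, X (k * h) ω < -K} =ᵐ[P]
      (fun ω (i : Fin N) ↦ ξ i ω) ⁻¹' B := by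
    refine eventuallyEq_set.2 ?_
    filter_upwards [hX.start_zero] with ω h0
    have hS (k : Fin (N + 1)) : ∑ i : Fin N with i.1 < k.1, ξ i ω = X (k * h) ω := by
      rw [hsum k fun i ↦ ξ i ω, hξ, Finset.sum_range_sub (fun i : ℕ ↦ X (i * h) ω)]
      simp [h0]
    simp only [B, Set.mem_preimage, Set.mem_iUnion, Set.mem_ofPred_eq, hS]
    exact ⟨fun ⟨k, hk, h⟩ ↦ ⟨⟨k, Nat.lt_succ_of_le hk⟩, h⟩,
      fun ⟨k, h⟩ ↦ ⟨k, Nat.lt_succ_iff.1 k.2, h⟩⟩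
  have hbwd : {ω | ∃ k ≤ N, X (N * h) ω - X (k * h) ω < -K} =
      (fun ω (i : Fin N) ↦ ξ (e i) ω) ⁻¹' B := by
    ext ω
    have hS (k : Fin (N + 1)) : ∑ i : Fin N with i.1 < k.1, ξ (e i) ω =
        X (N * h) ω - X ((N - k : ℕ) * h) ω := by
      have hterm : ∀ i ∈ Finset.range k, ξ (N - 1 - i) ω =
          -X ((N - (i + 1) : ℕ) * h) ω - -X ((N - i : ℕ) * h) ω := fun i hi ↦ by
        have h1 : i < k := Finset.mem_range.1 hi
        have h2 := k.2
        have h3 : N - 1 - i + 1 = N - i := by omega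
        have h4 : N - 1 - i = N - (i + 1) := by omega
        simp only [hξ, h3]
        rw [h4]
        ring
      rw [hsum k fun i ↦ ξ (N - 1 - i) ω, Finset.sum_congr rfl hterm,
        Finset.sum_range_sub (fun i : ℕ ↦ -X ((N - i : ℕ) * h) ω)]
      simp only [tsub_zero]
      ring
    simp only [B, Set.mem_preimage, Set.mem_iUnion, Set.mem_ofPred_eq, hS]
    refine ⟨fun ⟨k, hk, h⟩ ↦ ⟨⟨N - k, by omega⟩, ?_⟩, fun ⟨k, h⟩ ↦ ⟨N - k, by omega, h⟩⟩
    simpa [Nat.sub_sub_self hk] using h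
  rw [hbwd, measure_congr hfwd, hpi.measure_mem_eq hB]

/-- A Lévy process with positive mean is bounded below. -/
theorem exists_measure_exists_lt_le [IsProbabilityMeasure P]
    (hX : IsLevyProcess X P) (hint : Integrable (X 1) P)
    (hpos : 0 < ∫ ω, X 1 ω ∂P) {ε : ENNReal} (hε : ε ≠ 0) :
    ∃ K : ℝ, P {ω | ∃ s, X s ω < -K} ≤ ε := by
  obtain ⟨K, hK⟩ := hX.exists_measure_exists_dyadic_lt_le hint hpos hε
  refine ⟨K, measure_le_of_ae_eventually_mem hK ?_⟩
  filter_upwards [hX.cadlag_paths] with ω hω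
  rintro ⟨s, hs⟩
  filter_upwards [hω.eventually_exists_dyadic (lt_add_one s) isOpen_Iio hs] with j hj
  exact ⟨hj.choose, hj.choose_spec.2⟩

/-- The increments of a Lévy process with positive mean over the intervals that end at an integer
time `n` are bounded below, uniformly in `n`. -/
theorem exists_forall_measure_exists_sub_lt_le [IsProbabilityMeasure P]
    (hX : IsLevyProcess X P) (hint : Integrable (X 1) P) (hpos : 0 < ∫ ω, X 1 ω ∂P) {ε : ENNReal} (hε : ε ≠ 0) :
    ∃ K : ℝ, ∀ n : ℕ, P {ω | ∃ s ≤ (n : ℝ≥0), X n ω - X s ω < -K} ≤ ε := by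
  obtain ⟨K, hK⟩ := hX.exists_measure_exists_dyadic_lt_le hint hpos hε
  -- A nonnegative bound excludes `s = n`, so that dyadic times in `[s, n]` are available.
  refine ⟨max K 0, fun n ↦ ?_⟩
  -- On the grid of mesh `2⁻ʲ`, the time `n` has index `n * 2 ^ j`.
  refine measure_le_of_ae_eventually_mem (E := fun j ↦
    {ω | ∃ k ≤ n * 2 ^ j, X ((n * 2 ^ j : ℕ) * (2 ^ j)⁻¹) ω - X (k * (2 ^ j)⁻¹) ω < -K})
    (fun j ↦ ?_) ?_
  · rw [hX.measure_exists_sub_lt_eq]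
    refine (measure_mono ?_).trans (hK j)
    rintro ω ⟨k, -, hk⟩
    exact ⟨k, by rwa [div_eq_mul_inv]⟩
  · filter_upwards [hX.cadlag_paths] with ω hω
    rintro ⟨s, hsn, hs⟩
    have hne : s ≠ n := by
      rintro rfl
      have := le_max_right K 0
      linarith
    have hs' : X s ω ∈ Set.Ioi (X n ω + K) := by
      have := le_max_left K 0
      rw [Set.mem_Ioi]
      linarith
    filter_upwards [hω.eventually_exists_dyadic (lt_of_le_of_ne hsn hne) isOpen_Ioi hs'] with j hj
    obtain ⟨k, hkn, hk⟩ := hj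
    refine ⟨k, ?_, ?_⟩
    · rw [div_le_iff₀ (by positivity)] at hkn
      exact_mod_cast hkn
    · have hn : ((n * 2 ^ j : ℕ) : ℝ≥0) * (2 ^ j)⁻¹ = n := by
        push_cast
        rw [mul_assoc, mul_inv_cancel₀ (by positivity), mul_one]
      rw [hn, ← div_eq_mul_inv]
      rw [Set.mem_Ioi] at hk
      linarith

end IsLevyProcess

/-! ### The central limit theorem for Lévy processes -/

namespace IsLevyProcess

variable {Ω : Type*} [MeasurableSpace Ω] {P : Measure Ω} [IsProbabilityMeasure P]
  {W : ℝ≥0 → Ω → ℝ}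

/-- The central limit theorem for a Lévy process along the integers, as a statement about upper
tails. -/
theorem tendsto_measureReal_lt_nat (hW : IsLevyProcess W P) (hL2 : MemLp (W 1) 2 P)
    (hvar : 0 < variance (W 1) P) (y : ℝ) :
    Tendsto (fun n : ℕ ↦ P.real {ω | n * (∫ ω, W 1 ω ∂P) - y * √(n * variance (W 1) P) < W n ω})
      atTop (𝓝 (stdNormalCDF y)) := by
  set v := variance (W 1) P with hv
  set m := ∫ ω, W 1 ω ∂P with hm
  set ξ : ℕ → Ω → ℝ := fun i ω ↦ W ((i + 1 : ℕ) : ℝ≥0) ω - W (i : ℝ≥0) ω with hξ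
  have hid : ∀ i, IdentDistrib (ξ i) (W 1) P P := fun i ↦ by
    simpa [hξ] using hW.stationary_increments i 1
  have hindep : iIndepFun ξ P := hW.indep_increments.nat (t := fun i : ℕ ↦ (i : ℝ≥0)) Nat.mono_cast
  have hsd : 0 < √v := Real.sqrt_pos.2 hvar
  have hlaw : HasLaw (fun x ↦ √v * x) (gaussianReal 0 Var[ξ 0; P].toNNReal) (gaussianReal 0 1) := by
    refine ⟨by fun_prop, ?_⟩
    rw [gaussianReal_map_const_mul, (hid 0).variance_eq, ← hv]
    congr 1
    · simp
    · ext
      simp [Real.sq_sqrt hvar.le, hvar.le]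
  have hclt := (tendstoInDistribution_inv_sqrt_mul_sum_sub hlaw ((hid 0).memLp_iff.2 hL2) hindep
    fun i ↦ (hid i).trans (hid 0).symm)
  have hlim := ProbabilityMeasure.tendsto_measure_of_null_frontier_of_tendsto' hclt.tendsto
    (E := Set.Ioi (-y * √v)) (by
      have := nullSingletonClass_gaussianReal (μ := 0) (v := Var[ξ 0; P].toNNReal) (by
        rw [(hid 0).variance_eq]
        simpa using hvar)
      simp [hlaw.map_eq])
  simp only [ProbabilityMeasure.coe_mk] at hlim
  have hlim' := (ENNReal.tendsto_toReal (measure_ne_top _ _)).comp hlim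
  have hpre : (fun x ↦ √v * x) ⁻¹' Set.Ioi (-y * √v) = Set.Ioi (-y) := by
    ext x
    rw [Set.mem_preimage, Set.mem_Ioi, Set.mem_Ioi, mul_comm, mul_lt_mul_iff_right₀ hsd]
  have hval : (((gaussianReal 0 1).map fun x ↦ √v * x) (Set.Ioi (-y * √v))).toReal =
      stdNormalCDF y := by
    rw [Measure.map_apply (by fun_prop) measurableSet_Ioi, hpre, ← gaussianReal_real_Ioi_neg]
    rfl
  rw [hval] at hlim'
  refine hlim'.congr' ?_
  filter_upwards [eventually_gt_atTop 0] with n hn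
  have hnpos : (0 : ℝ) < n := by exact_mod_cast hn
  have hsn : 0 < √(n : ℝ) := Real.sqrt_pos.2 hnpos
  rw [Function.comp_apply, Measure.map_apply_of_aemeasurable (hclt.forall_aemeasurable n)
    measurableSet_Ioi, measureReal_def]
  congr 1
  refine measure_congr (eventuallyEq_set.2 ?_)
  filter_upwards [hW.start_zero] with ω h0
  have hsum : ∑ i ∈ Finset.range n, ξ i ω = W n ω := by
    rw [hξ, Finset.sum_range_sub (fun i : ℕ ↦ W (i : ℝ≥0) ω)]
    simp [h0]
  rw [Set.mem_preimage, Set.mem_Ioi, hsum, (hid 0).integral_eq, ← hm,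
    ← div_eq_inv_mul, lt_div_iff₀ hsn]
  change _ ↔ n * m - y * √(n * v) < W n ω
  rw [Real.sqrt_mul hnpos.le]
  constructor <;> intro h <;> nlinarith

end IsLevyProcess

/-- Let `n` be an integer time within a bounded distance of `u / m + x √(u v / m³)`. In the
standardisation of the central limit theorem at time `n`, the level `u - K` corresponds to a point
that tends to `-x`. -/
theorem tendsto_standardized_horizon {m v : ℝ} (hm : 0 < m) (hv : 0 < v) (x K : ℝ) (δ : ℕ) :
    Tendsto (fun u : ℝ ↦ ⌊u / m + x * passageScale m v u⌋₊ + δ) atTop atTop ∧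
    Tendsto (fun u : ℝ ↦ (((⌊u / m + x * passageScale m v u⌋₊ + δ : ℕ) : ℝ) * m - (u - K)) /
      √((⌊u / m + x * passageScale m v u⌋₊ + δ : ℕ) * v)) atTop (𝓝 x) := by
  set c := v / m ^ 3 with hc
  have hcpos : 0 < c := by positivity
  set t : ℝ → ℝ := fun u ↦ u / m + x * passageScale m v u with ht
  set n : ℝ → ℕ := fun u ↦ ⌊t u⌋₊ + δ with hn
  have hscale : Tendsto (fun u ↦ passageScale m v u / u) atTop (𝓝 0) := by
    have h1 : Tendsto (fun u : ℝ ↦ √(c / u)) atTop (𝓝 0) := by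
      simpa using (tendsto_const_nhds.div_atTop tendsto_id : Tendsto (fun u : ℝ ↦ c / u) _ _).sqrt
    refine h1.congr' ?_
    filter_upwards [eventually_gt_atTop 0] with u hu
    rw [passageScale, ← hc, eq_div_iff hu.ne']
    nth_rw 2 [← Real.sqrt_sq hu.le]
    rw [← Real.sqrt_mul (by positivity)]
    congr 1
    field_simp
  have htu : Tendsto (fun u ↦ t u / u) atTop (𝓝 (1 / m)) := by
    have h1 : Tendsto (fun u ↦ 1 / m + x * (passageScale m v u / u)) atTop (𝓝 (1 / m)) := by
      simpa using (hscale.const_mul x).const_add (1 / m)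
    refine h1.congr' ?_
    filter_upwards [eventually_gt_atTop 0] with u hu
    simp only [ht]
    field_simp
  have htop : Tendsto t atTop atTop := by
    refine (tendsto_id.atTop_mul_pos (one_div_pos.2 hm) htu).congr' ?_
    filter_upwards [eventually_gt_atTop 0] with u hu
    simp only [id]
    field_simp
  have hntop : Tendsto n atTop atTop :=
    tendsto_atTop_mono (fun u ↦ Nat.le_add_right _ _)
      ((tendsto_nat_floor_atTop (α := ℝ)).comp htop)
  have hnR : Tendsto (fun u ↦ (n u : ℝ)) atTop atTop := tendsto_natCast_atTop_atTop.comp hntop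
  -- Rounding changes the time by a bounded amount, which is negligible on the scale `√n`.
  have hD : ∀ᶠ u in atTop, |(n u : ℝ) - t u| ≤ 1 + δ := by
    filter_upwards [htop.eventually_ge_atTop 0] with u hu
    have h1 := Nat.floor_le hu
    have h2 := Nat.lt_floor_add_one (t u)
    simp only [hn]
    push_cast
    have : (0 : ℝ) ≤ δ := δ.cast_nonneg
    rw [abs_le]
    constructor <;> linarith
  have hnu : Tendsto (fun u ↦ (n u : ℝ) / u) atTop (𝓝 (1 / m)) := by
    have h1 : Tendsto (fun u ↦ ((n u : ℝ) - t u) / u) atTop (𝓝 0) := by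
      refine squeeze_zero_norm' (a := fun u ↦ (1 + δ) / u) ?_
        (tendsto_const_nhds.div_atTop tendsto_id)
      filter_upwards [hD, eventually_gt_atTop 0] with u hu hu0
      rw [norm_div, Real.norm_eq_abs, Real.norm_of_nonneg hu0.le]
      gcongr
    have h2 := h1.add htu
    rw [zero_add] at h2
    refine h2.congr fun u ↦ ?_
    ring
  refine ⟨hntop, ?_⟩
  have hsqrt : Tendsto (fun u ↦ √((n u : ℝ) * v)) atTop atTop :=
    Real.tendsto_sqrt_atTop.comp (hnR.atTop_mul_const hv)
  have hA : Tendsto (fun u ↦ (m * ((n u : ℝ) - t u) + K) / √((n u : ℝ) * v)) atTop (𝓝 0) := by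
    refine squeeze_zero_norm' (a := fun u ↦ (m * (1 + δ) + |K|) / √((n u : ℝ) * v)) ?_
      (tendsto_const_nhds.div_atTop hsqrt)
    filter_upwards [hD] with u hu
    rw [norm_div, Real.norm_eq_abs, Real.norm_of_nonneg (Real.sqrt_nonneg _)]
    gcongr
    refine (abs_add_le _ _).trans ?_
    rw [abs_mul, abs_of_pos hm]
    gcongr
  have hB : Tendsto (fun u ↦ m * x * (passageScale m v u / √((n u : ℝ) * v))) atTop (𝓝 x) := by
    have h1 : Tendsto (fun u ↦ √((n u / u : ℝ)⁻¹ * (1 / m ^ 3))) atTop (𝓝 (1 / m)) := by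
      have h2 := ((hnu.inv₀ (by positivity)).mul_const (1 / m ^ 3)).sqrt
      have h3 : √((1 / m)⁻¹ * (1 / m ^ 3)) = 1 / m := by
        rw [Real.sqrt_eq_iff_mul_self_eq_of_pos (by positivity)]
        field_simp
      rwa [h3] at h2
    have h4 := h1.const_mul (m * x)
    have h5 : m * x * (1 / m) = x := by field_simp
    rw [h5] at h4
    refine h4.congr' ?_
    filter_upwards [eventually_gt_atTop 0, hnR.eventually_gt_atTop 0] with u hu hnu
    rw [passageScale, ← Real.sqrt_div (by positivity)]
    congr 2
    field_simp
  have hAB := hA.add hB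
  rw [zero_add] at hAB
  refine hAB.congr fun u ↦ ?_
  have htm : m * t u = u + m * x * passageScale m v u := by
    simp only [ht]
    field_simp
  change _ = ((n u : ℝ) * m - (u - K)) / √((n u : ℝ) * v)
  rw [mul_div_assoc', ← add_div]
  congr 1
  linarith

/-! ### Transfer of the central limit theorem to the passage times -/

section Transfer

variable {Ω : Type*} [MeasurableSpace Ω] {P : Measure Ω} [IsProbabilityMeasure P]
  {W : ℝ≥0 → Ω → ℝ}

/-- The probability that a Lévy process with positive mean exceeds the level `u - K` at the
integer time next to `u / m + x √(u ω² / m³)`. -/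
theorem IsLevyProcess.tendsto_measureReal_lt_floor (hW : IsLevyProcess W P)
    (hL2 : MemLp (W 1) 2 P) (hvar : 0 < variance (W 1) P) (hm : 0 < ∫ ω, W 1 ω ∂P)
    (x K : ℝ) (δ : ℕ) :
    Tendsto (fun u : ℝ ↦ P.real {ω | u - K <
        W ((⌊u / (∫ ω, W 1 ω ∂P) + x * passageScale (∫ ω, W 1 ω ∂P) (variance (W 1) P) u⌋₊ + δ : ℕ)
          : ℝ≥0) ω}) atTop (𝓝 (stdNormalCDF x)) := by
  set m := ∫ ω, W 1 ω ∂P with hmdef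
  set v := variance (W 1) P with hv
  obtain ⟨hn, hy⟩ := tendsto_standardized_horizon hm hvar x K δ
  set n : ℝ → ℕ := fun u ↦ ⌊u / m + x * passageScale m v u⌋₊ + δ with hndef
  set y : ℝ → ℝ := fun u ↦ ((n u : ℝ) * m - (u - K)) / √(n u * v) with hydef
  have hpolya := tendsto_sub_of_monotone_of_tendsto (l := atTop)
    (F := fun (u : ℝ) (y : ℝ) ↦ P.real {ω | n u * m - y * √(n u * v) < W (n u) ω})
    (Φ := stdNormalCDF)
    (fun u y y' hyy' ↦ measureReal_mono fun ω hω ↦ by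
      rw [Set.mem_ofPred_eq] at hω ⊢
      exact lt_of_le_of_lt (by gcongr) hω)
    (fun _ _ ↦ measureReal_nonneg) (fun _ _ ↦ measureReal_le_one)
    (fun y ↦ (hW.tendsto_measureReal_lt_nat hL2 hvar y).comp hn)
    continuous_stdNormalCDF (tendsto_cdf_atBot _) (tendsto_cdf_atTop _) y
  have hlim := hpolya.add ((continuous_stdNormalCDF.tendsto x).comp hy)
  rw [zero_add] at hlim
  refine hlim.congr' ?_
  filter_upwards [hn.eventually_gt_atTop 0] with u hu
  have hpos : 0 < √(n u * v) := Real.sqrt_pos.2 (mul_pos (by exact_mod_cast hu) hvar)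
  have hlevel : n u * m - y u * √(n u * v) = u - K := by
    rw [hydef, div_mul_cancel₀ _ hpos.ne']
    ring
  simp only [Function.comp_apply, hlevel]
  change P.real {ω | u - K < W (n u) ω} - stdNormalCDF (y u) + stdNormalCDF (y u) = _
  ring

/-- Normal approximation of a family `F u` of distribution functions that are squeezed, up to a
bounded shift of the level and up to an arbitrarily small probability, between upper tails of a
Lévy process `W` at neighbouring integer times. -/
theorem IsLevyProcess.tendsto_sub_stdNormalCDF (hW : IsLevyProcess W P)
    (hL2 : MemLp (W 1) 2 P) (hvar : 0 < variance (W 1) P) (hm : 0 < ∫ ω, W 1 ω ∂P)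
    {F : ℝ → ℝ → ℝ} (hmono : ∀ u, Monotone (F u)) (h0 : ∀ u t, 0 ≤ F u t) (h1 : ∀ u t, F u t ≤ 1)
    (hlower : ∀ u t, 0 ≤ t → P.real {ω | u < W (⌊t⌋₊ : ℝ≥0) ω} ≤ F u t)
    (hupper : ∀ ε > 0, ∃ K : ℝ, ∀ u t, 0 ≤ t →
      F u t ≤ P.real {ω | u - K < W ((⌊t⌋₊ + 1 : ℕ) : ℝ≥0) ω} + ε) (g : ℝ → ℝ) :
    Tendsto (fun u : ℝ ↦ F u (g u) -
      stdNormalCDF (normalizedHorizon (∫ ω, W 1 ω ∂P) (variance (W 1) P) g u)) atTop (𝓝 0) := by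
  set m := ∫ ω, W 1 ω ∂P with hmdef
  set v := variance (W 1) P with hv
  have hpt (x : ℝ) : Tendsto (fun u ↦ F u (u / m + x * passageScale m v u)) atTop
      (𝓝 (stdNormalCDF x)) := by
    have htop : ∀ᶠ u in atTop, 0 ≤ u / m + x * passageScale m v u := by
      filter_upwards [(tendsto_standardized_horizon hm hvar x 0 0).1.eventually_gt_atTop 0] with u hu
      by_contra! h
      simp [Nat.floor_of_nonpos h.le] at hu
    refine tendsto_order.2 ⟨fun b hb ↦ ?_, fun b hb ↦ ?_⟩
    · have hlim := hW.tendsto_measureReal_lt_floor hL2 hvar hm x 0 0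
      filter_upwards [hlim.eventually_const_lt hb, htop] with u hu hu0
      refine hu.trans_le ?_
      simpa using hlower u _ hu0
    · obtain ⟨ε, hε, hεb⟩ : ∃ ε > 0, stdNormalCDF x < b - ε :=
        ⟨(b - stdNormalCDF x) / 2, by linarith, by linarith⟩
      obtain ⟨K, hK⟩ := hupper ε hε
      have hlim := hW.tendsto_measureReal_lt_floor hL2 hvar hm x K 1
      filter_upwards [hlim.eventually_lt_const hεb, htop] with u hu hu0
      have := hK u _ hu0
      linarith
  have hpolya := tendsto_sub_of_monotone_of_tendsto (l := atTop)
    (F := fun u y ↦ F u (u / m + y * passageScale m v u)) (Φ := stdNormalCDF)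
    (fun u y y' hyy' ↦ hmono u (by have : 0 ≤ passageScale m v u := Real.sqrt_nonneg _; gcongr))
    (fun _ _ ↦ h0 _ _) (fun _ _ ↦ h1 _ _) hpt continuous_stdNormalCDF (tendsto_cdf_atBot _)
    (tendsto_cdf_atTop _) (normalizedHorizon m v g)
  refine hpolya.congr' ?_
  filter_upwards [eventually_gt_atTop 0] with u hu
  have hs : passageScale m v u ≠ 0 := (passageScale_pos hm hvar hu).ne'
  rw [normalizedHorizon, div_mul_cancel₀ _ hs, add_sub_cancel]

end Transfer

/-- Away from the left tail, an additive normal approximation is also a relative one. -/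
theorem tendsto_div_stdNormalCDF {p x : ℝ → ℝ}
    (h : Tendsto (fun u ↦ p u - stdNormalCDF (x u)) atTop (𝓝 0))
    (hx : ∃ C : ℝ, ∀ᶠ u in atTop, C ≤ x u) :
    Tendsto (fun u ↦ p u / stdNormalCDF (x u)) atTop (𝓝 1) := by
  obtain ⟨C, hC⟩ := hx
  have h1 : Tendsto (fun u ↦ (p u - stdNormalCDF (x u)) / stdNormalCDF (x u)) atTop (𝓝 0) := by
    have h2 : Tendsto (fun u ↦ |p u - stdNormalCDF (x u)| / stdNormalCDF C) atTop (𝓝 0) := by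
      simpa using h.abs.div_const (stdNormalCDF C)
    refine squeeze_zero_norm' ?_ h2
    filter_upwards [hC] with u hu
    rw [norm_div, Real.norm_eq_abs, Real.norm_of_nonneg (stdNormalCDF_pos _).le]
    gcongr
    exacts [stdNormalCDF_pos C, monotone_stdNormalCDF hu]
  have h2 := h1.add_const 1
  rw [zero_add] at h2
  refine h2.congr fun u ↦ ?_
  have := (stdNormalCDF_pos (x u)).ne'
  field_simp
  ring

/-! ### First passage of the reflected process -/

section Reflected

variable {Ω : Type*} {X Y : ℝ≥0 → Ω → ℝ} {u : ℝ} {ω : Ω}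

theorem exists_lt_of_lt_reflectedProcess {s : ℝ≥0} (h : u < reflectedProcess X Y s ω) :
    ∃ r ≤ s, u < X s ω - (X r ω - Y r ω) := by
  have h1 : sInf ((fun s ↦ X s ω - Y s ω) '' Set.Icc 0 s) < X s ω - u := by
    rw [reflectedProcess] at h
    linarith
  obtain ⟨_, ⟨r, hr, rfl⟩, hlt⟩ := exists_lt_of_csInf_lt
    ((Set.nonempty_Icc.2 zero_le).image _) h1
  exact ⟨r, hr.2, by linarith⟩

theorem le_reflectedProcess (hc : IsCadlagPath fun t ↦ X t ω - Y t ω) {r s : ℝ≥0} (hrs : r ≤ s) :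
    X s ω - (X r ω - Y r ω) ≤ reflectedProcess X Y s ω := by
  obtain ⟨C, hC⟩ := hc.exists_abs_le s
  have hbdd : BddBelow ((fun s ↦ X s ω - Y s ω) '' Set.Icc 0 s) := by
    refine ⟨-C, ?_⟩
    rintro _ ⟨t, ht, rfl⟩
    exact (abs_le.1 (hC t ht.2)).1
  exact sub_le_sub_left (csInf_le hbdd ⟨r, ⟨zero_le, hrs⟩, rfl⟩) _

theorem firstPassageTime_le {V : ℝ≥0 → Ω → ℝ} {s : ℝ≥0} (h : u < V s ω) :
    firstPassageTime V u ω ≤ ((s : ℝ) : EReal) :=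
  sInf_le ⟨s, h, rfl⟩

theorem exists_lt_of_firstPassageTime_lt {V : ℝ≥0 → Ω → ℝ} {T : ℝ≥0}
    (h : firstPassageTime V u ω < ((T : ℝ) : EReal)) : ∃ s ≤ T, u < V s ω := by
  obtain ⟨_, ⟨s, hs, rfl⟩, hlt⟩ := sInf_lt_iff.1 h
  exact ⟨s, NNReal.coe_le_coe.1 (EReal.coe_le_coe_iff.1 hlt.le), hs⟩

/-- The normal approximation for the first passage time of the reflected process, when `W` is a
Lévy process below it such that the excess over `W n` of all values of the reflected process up to
time `n` is bounded above in probability, uniformly in `n`. Only monotonicity and subadditivity of the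
(outer) measure are applied to passage events, so their measurability plays no role. -/
theorem tendsto_firstPassageTime_sub_stdNormalCDF [MeasurableSpace Ω] {P : Measure Ω}
    [IsProbabilityMeasure P] {W : ℝ≥0 → Ω → ℝ} (hW : IsLevyProcess W P)
    (hL2 : MemLp (W 1) 2 P) (hvar : 0 < variance (W 1) P) (hm : 0 < ∫ ω, W 1 ω ∂P)
    (hbelow : ∀ᵐ ω ∂P, ∀ t, W t ω ≤ reflectedProcess X Y t ω)
    (htight : ∀ ε : ENNReal, ε ≠ 0 → ∃ K : ℝ, ∀ n : ℕ,
      P {ω | ∃ s ≤ (n : ℝ≥0), ∃ r ≤ s, W n ω + K < X s ω - (X r ω - Y r ω)} ≤ ε) (g : ℝ → ℝ) :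
    Tendsto (fun u : ℝ ↦
      P.real {ω | firstPassageTime (reflectedProcess X Y) u ω ≤ (g u : EReal)} -
        stdNormalCDF (normalizedHorizon (∫ ω, W 1 ω ∂P) (variance (W 1) P) g u))
      atTop (𝓝 0) := by
  refine hW.tendsto_sub_stdNormalCDF hL2 hvar hm
    (F := fun u t ↦ P.real {ω | firstPassageTime (reflectedProcess X Y) u ω ≤ (t : EReal)})
    (fun u t t' htt' ↦ measureReal_mono fun ω (hω : _ ≤ _) ↦
      hω.trans (EReal.coe_le_coe_iff.2 htt'))
    (fun _ _ ↦ measureReal_nonneg) (fun _ _ ↦ measureReal_le_one) (fun u t ht ↦ ?_)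
    (fun ε hε ↦ ?_) g
  · refine ENNReal.toReal_mono (measure_ne_top _ _) (measure_mono_ae ?_)
    filter_upwards [hbelow] with ω hω (hu : u < _)
    refine (firstPassageTime_le (hu.trans_le (hω _))).trans ?_
    exact EReal.coe_le_coe_iff.2 (by simpa using Nat.floor_le ht)
  · obtain ⟨K, hK⟩ := htight (ENNReal.ofReal ε) (by simpa using hε)
    refine ⟨K, fun u t ht ↦ ?_⟩
    calc P.real {ω | firstPassageTime (reflectedProcess X Y) u ω ≤ (t : EReal)}
        ≤ P.real ({ω | u - K < W ((⌊t⌋₊ + 1 : ℕ) : ℝ≥0) ω} ∪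
          {ω | ∃ s ≤ ((⌊t⌋₊ + 1 : ℕ) : ℝ≥0), ∃ r ≤ s,
            W ((⌊t⌋₊ + 1 : ℕ) : ℝ≥0) ω + K < X s ω - (X r ω - Y r ω)}) := by
          refine measureReal_mono fun ω hω ↦ ?_
          rw [Set.mem_ofPred_eq] at hω
          have hlt : (t : EReal) < (((⌊t⌋₊ + 1 : ℕ) : ℝ≥0) : ℝ) :=
            EReal.coe_lt_coe_iff.2 (by simpa using Nat.lt_floor_add_one t)
          obtain ⟨s, hs, hus⟩ := exists_lt_of_firstPassageTime_lt (hω.trans_lt hlt)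
          obtain ⟨r, hr, hur⟩ := exists_lt_of_lt_reflectedProcess hus
          rcases lt_or_ge (u - K) (W ((⌊t⌋₊ + 1 : ℕ) : ℝ≥0) ω) with h | h
          · exact Or.inl h
          · exact Or.inr ⟨s, hs, r, hr, by linarith⟩
      _ ≤ _ := (measureReal_union_le _ _).trans
          (add_le_add_right (ENNReal.toReal_le_of_le_ofReal hε.le (hK _)) _)

end Reflected

/-! ### Tightness of the excess in the two drift regimes -/

section Excess

variable {Ω : Type*} [MeasurableSpace Ω] {P : Measure Ω} [IsProbabilityMeasure P]
  {X Y : ℝ≥0 → Ω → ℝ}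

/-- If `X - Y` has positive drift, then `X s - (X r - Y r)` exceeds `X n` by at most
`-(X n - X s)` plus `-inf (X - Y)`. -/
theorem exists_measure_excess_le_of_pos (hX : IsLevyProcess X P)
    (hZ : IsLevyProcess (fun t ω ↦ X t ω - Y t ω) P) (hXint : Integrable (X 1) P)
    (hZint : Integrable (fun ω ↦ X 1 ω - Y 1 ω) P) (hmX : 0 < ∫ ω, X 1 ω ∂P)
    (hmZ : 0 < ∫ ω, (X 1 ω - Y 1 ω) ∂P) {ε : ENNReal} (hε : ε ≠ 0) :
    ∃ K : ℝ, ∀ n : ℕ,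
      P {ω | ∃ s ≤ (n : ℝ≥0), ∃ r ≤ s, X n ω + K < X s ω - (X r ω - Y r ω)} ≤ ε := by
  obtain ⟨K₁, hK₁⟩ := hX.exists_forall_measure_exists_sub_lt_le hXint hmX (ε := ε / 2)
    (by simp [hε])
  obtain ⟨K₂, hK₂⟩ := hZ.exists_measure_exists_lt_le hZint hmZ (ε := ε / 2) (by simp [hε])
  refine ⟨K₁ + K₂, fun n ↦ ?_⟩
  calc _ ≤ P ({ω | ∃ s ≤ (n : ℝ≥0), X n ω - X s ω < -K₁} ∪ {ω | ∃ s, X s ω - Y s ω < -K₂}) := by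
        refine measure_mono ?_
        rintro ω ⟨s, hs, r, -, h⟩
        by_contra hcon
        rw [Set.mem_union, not_or] at hcon
        have h1 : -K₁ ≤ X n ω - X s ω := not_lt.1 fun h' ↦ hcon.1 ⟨s, hs, h'⟩
        have h2 : -K₂ ≤ X r ω - Y r ω := not_lt.1 fun h' ↦ hcon.2 ⟨r, h'⟩
        linarith
    _ ≤ ε / 2 + ε / 2 := (measure_union_le _ _).trans (add_le_add (hK₁ n) hK₂)
    _ = ε := ENNReal.add_halves ε

/-- If `Y - X` has positive drift, then `X s - (X r - Y r)` exceeds `Y n` by at most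
`-(X n - X s)` minus the increment of `Y - X` over `[r, n]`. -/
theorem exists_measure_excess_le_of_neg (hX : IsLevyProcess X P)
    (hZ : IsLevyProcess (fun t ω ↦ X t ω - Y t ω) P) (hXint : Integrable (X 1) P)
    (hZint : Integrable (fun ω ↦ X 1 ω - Y 1 ω) P) (hmX : 0 < ∫ ω, X 1 ω ∂P)
    (hmZ : ∫ ω, (X 1 ω - Y 1 ω) ∂P < 0) {ε : ENNReal} (hε : ε ≠ 0) :
    ∃ K : ℝ, ∀ n : ℕ,
      P {ω | ∃ s ≤ (n : ℝ≥0), ∃ r ≤ s, Y n ω + K < X s ω - (X r ω - Y r ω)} ≤ ε := by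
  obtain ⟨K₁, hK₁⟩ := hX.exists_forall_measure_exists_sub_lt_le hXint hmX (ε := ε / 2)
    (by simp [hε])
  obtain ⟨K₂, hK₂⟩ := hZ.neg.exists_forall_measure_exists_sub_lt_le hZint.neg
    (by rw [integral_neg]; linarith) (ε := ε / 2) (by simp [hε])
  refine ⟨K₁ + K₂, fun n ↦ ?_⟩
  calc _ ≤ P ({ω | ∃ s ≤ (n : ℝ≥0), X n ω - X s ω < -K₁} ∪
          {ω | ∃ s ≤ (n : ℝ≥0), -(X n ω - Y n ω) - -(X s ω - Y s ω) < -K₂}) := by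
        refine measure_mono ?_
        rintro ω ⟨s, hs, r, hr, h⟩
        by_contra hcon
        rw [Set.mem_union, not_or] at hcon
        have h1 : -K₁ ≤ X n ω - X s ω := not_lt.1 fun h' ↦ hcon.1 ⟨s, hs, h'⟩
        have h2 : -K₂ ≤ -(X n ω - Y n ω) - -(X r ω - Y r ω) :=
          not_lt.1 fun h' ↦ hcon.2 ⟨r, hr.trans hs, h'⟩
        linarith
    _ ≤ ε / 2 + ε / 2 := (measure_union_le _ _).trans (add_le_add (hK₁ n) (hK₂ n))
    _ = ε := ENNReal.add_halves ε

end Excess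

theorem mainTheorem6 {Ω : Type*} [MeasurableSpace Ω] (P : Measure Ω) [IsProbabilityMeasure P]
    (X Y : ℝ≥0 → Ω → ℝ) (hX : IsLevyProcess X P) (hY : IsLevyProcess Y P)
    (hXY : IndepFun (fun ω t ↦ X t ω) (fun ω t ↦ Y t ω) P)
    (hXint : Integrable (X 1) P) (hYint : Integrable (Y 1) P)
    (hmX : 0 < ∫ ω, X 1 ω ∂P) (g : ℝ → ℝ) :
    (0 < ∫ ω, (X 1 ω - Y 1 ω) ∂P → MemLp (X 1) 2 P → 0 < variance (X 1) P →
      (∀ u : ℝ, 0 < u →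
        P.real {ω | firstPassageTime (reflectedProcess X Y) u ω ≤ (g u : EReal)} =
          P.real {ω | (firstPassageTime (reflectedProcess X Y) u ω
                - ((u / ∫ ω, X 1 ω ∂P : ℝ) : EReal)) /
              (passageScale (∫ ω, X 1 ω ∂P) (variance (X 1) P) u : EReal) ≤
            (normalizedHorizon (∫ ω, X 1 ω ∂P) (variance (X 1) P) g u : EReal)}) ∧
      Tendsto (fun u : ℝ ↦
          P.real {ω | firstPassageTime (reflectedProcess X Y) u ω ≤ (g u : EReal)} -
            stdNormalCDF (normalizedHorizon (∫ ω, X 1 ω ∂P) (variance (X 1) P) g u))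
        atTop (𝓝 0) ∧
      ((∃ C : ℝ, ∀ᶠ u in atTop,
          C ≤ normalizedHorizon (∫ ω, X 1 ω ∂P) (variance (X 1) P) g u) →
        Tendsto (fun u : ℝ ↦
            P.real {ω | firstPassageTime (reflectedProcess X Y) u ω ≤ (g u : EReal)} /
              stdNormalCDF (normalizedHorizon (∫ ω, X 1 ω ∂P) (variance (X 1) P) g u))
          atTop (𝓝 1))) ∧
    (∫ ω, (X 1 ω - Y 1 ω) ∂P < 0 → MemLp (Y 1) 2 P → 0 < variance (Y 1) P →
      (∀ u : ℝ, 0 < u →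
        P.real {ω | firstPassageTime (reflectedProcess X Y) u ω ≤ (g u : EReal)} =
          P.real {ω | (firstPassageTime (reflectedProcess X Y) u ω
                - ((u / ∫ ω, Y 1 ω ∂P : ℝ) : EReal)) /
              (passageScale (∫ ω, Y 1 ω ∂P) (variance (Y 1) P) u : EReal) ≤
            (normalizedHorizon (∫ ω, Y 1 ω ∂P) (variance (Y 1) P) g u : EReal)}) ∧
      Tendsto (fun u : ℝ ↦
          P.real {ω | firstPassageTime (reflectedProcess X Y) u ω ≤ (g u : EReal)} -
            stdNormalCDF (normalizedHorizon (∫ ω, Y 1 ω ∂P) (variance (Y 1) P) g u))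
        atTop (𝓝 0) ∧
      ((∃ C : ℝ, ∀ᶠ u in atTop,
          C ≤ normalizedHorizon (∫ ω, Y 1 ω ∂P) (variance (Y 1) P) g u) →
        Tendsto (fun u : ℝ ↦
            P.real {ω | firstPassageTime (reflectedProcess X Y) u ω ≤ (g u : EReal)} /
              stdNormalCDF (normalizedHorizon (∫ ω, Y 1 ω ∂P) (variance (Y 1) P) g u))
          atTop (𝓝 1))) := by
  have hZ := hX.sub hY hXY
  have hZint : Integrable (fun ω ↦ X 1 ω - Y 1 ω) P := hXint.sub hYint
  -- The affine normalisation of the passage time does not change the event.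
  have hevent (m var : ℝ) (hm : 0 < m) (hvar : 0 < var) (u : ℝ) (hu : 0 < u) :
      P.real {ω | firstPassageTime (reflectedProcess X Y) u ω ≤ (g u : EReal)} =
        P.real {ω | (firstPassageTime (reflectedProcess X Y) u ω - ((u / m : ℝ) : EReal)) /
          (passageScale m var u : EReal) ≤ (normalizedHorizon m var g u : EReal)} := by
    simp only [normalizedHorizon, EReal.sub_div_le_sub_div_iff (passageScale_pos hm hvar hu)]
  refine ⟨fun hmZ hL2 hvar ↦ ?_, fun hmZ hL2 hvar ↦ ?_⟩
  · -- The process stays above `X`, the value at time `0` of the reflecting term being `0`.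
    have hlim := tendsto_firstPassageTime_sub_stdNormalCDF (Y := Y) hX hL2 hvar hmX (by
      filter_upwards [hX.start_zero, hY.start_zero, hZ.cadlag_paths] with ω hX0 hY0 hc t
      simpa [hX0, hY0] using le_reflectedProcess hc (zero_le (a := t)))
      (fun ε hε ↦ exists_measure_excess_le_of_pos hX hZ hXint hZint hmX hmZ hε) g
    exact ⟨hevent _ _ hmX hvar, hlim, tendsto_div_stdNormalCDF hlim⟩
  · have hmY : 0 < ∫ ω, Y 1 ω ∂P := by
      rw [integral_sub hXint hYint] at hmZ
      linarith
    -- The process stays above the barrier `Y`.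
    have hlim := tendsto_firstPassageTime_sub_stdNormalCDF (X := X) hY hL2 hvar hmY (by
      filter_upwards [hZ.cadlag_paths] with ω hc t
      simpa using le_reflectedProcess hc (le_refl t))
      (fun ε hε ↦ exists_measure_excess_le_of_neg hX hZ hXint hZint hmX hmZ hε) g
    exact ⟨hevent _ _ hmY hvar, hlim, tendsto_div_stdNormalCDF hlim⟩
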